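/- Let $\mathbb{Z}_2=\{1,-1\}$ and let $\mathbb{Z}_2^6$ act on $\mathbb{R}P^5$ by $(e_1,\dots,e_6)\cdot[z_1:\dots:z_6]=[e_1z_1:\dots:e_6z_6]$. Let $\mathbb{Z}_2^4$ act on $\mathbb{R}P^5$ through the homomorphism $$\mathbb{Z}_2^4\to\mathbb{Z}_2^6,\qquad (t_1,t_2,t_3,t_4)\mapsto(t_1t_2,\,t_1t_3,\,t_1t_4,\,t_2t_3,\,t_2t_4,\,t_3t_4).$$ Let $\Delta_{4,2}=\{x\in\mathbb{R}^4: 0\le x_i\le 1,\ x_1+x_2+x_3+x_4=2\}$, and let $\partial\Delta_{4,2}$ be its boundary relative to the hyperplane $x_1+x_2+x_3+x_4=2$. Then the orbit space $\mathbb{R}P^5/\mathbb{Z}_2^4$, with the quotient topology, is homeomorphic to the quotient space $$(\Delta_{4,2}\times\mathbb{R}P^2)/\approx,$$ where distinct points $(x,r)$ and $(y,r')$ satisfy $(x,r)\approx(y,r')$ if and only if $x=y\in\partial\Delta_{4,2}$. Moreover, $\mathbb{R}P^5/\mathbb{Z}_2^4$ is homeomorphic to the join $S^2*\mathbb{R}P^2$,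 that is, the quotient of $S^2\times\mathbb{R}P^2\times[0,1]$ by the identifications $(x,r,0)\sim(x,r',0)$ and $(x,r,1)\sim(x',r,1)$. -/

import Mathlib

open scoped LinearAlgebra.Projectivization

namespace OrbitSpace

/-- Real projective space `ℝP^n`, the space of lines through the origin of `ℝ^(n+1)`. -/
abbrev RP (n : ℕ) : Type := ℙ ℝ (Fin (n + 1) → ℝ)

/-- `ℝP^n` carries the quotient topology of `ℝ^(n+1) ∖ {0}`. -/
noncomputable instance instTopologicalSpaceRP (n : ℕ) : TopologicalSpace (RP n) :=
  TopologicalSpace.coinduced (Projectivization.mk' ℝ) inferInstance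

/-- The group `ℤ₂^n = {1, -1}^n`. Mathlib's pointwise action of `ℤ₂^(n+1)` on `ℝ^(n+1)` by
`(e • z) i = e i • z i` is linear and induces the canonical action of `ℤ₂^(n+1)` on `ℝP^n`. -/
abbrev Z2 (n : ℕ) : Type := Fin n → ℤˣ

instance instSMulCommClassZ2 (n : ℕ) : SMulCommClass (Z2 n) ℝ (Fin n → ℝ) :=
  ⟨fun e c z => funext fun i => smul_comm (e i) c (z i)⟩

/-- The homomorphism `ℤ₂^4 → ℤ₂^6`,
`(t₁, t₂, t₃, t₄) ↦ (t₁t₂, t₁t₃, t₁t₄, t₂t₃, t₂t₄, t₃t₄)`. -/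
def symSq : Z2 4 →* Z2 6 where
  toFun t := ![t 0 * t 1, t 0 * t 2, t 0 * t 3, t 1 * t 2, t 1 * t 3, t 2 * t 3]
  map_one' := by
    ext i
    fin_cases i <;> simp
  map_mul' s t := by
    funext i
    fin_cases i <;> simp [mul_mul_mul_comm]

/-- The action of `ℤ₂^4` on `ℝP^5`: the homomorphism `symSq` followed by the canonical action of
`ℤ₂^6` on `ℝP^5`. -/
noncomputable instance instMulActionRP5 : MulAction (Z2 4) (RP 5) :=
  MulAction.compHom (RP 5) symSq

/-- The orbit space `ℝP^5 / ℤ₂^4`, with the quotient topology. -/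
abbrev RP5ModZ24 : Type := MulAction.orbitRel.Quotient (Z2 4) (RP 5)

/-- The hypersimplex `Δ_{n,k} = {x ∈ ℝ^n : 0 ≤ x_i ≤ 1, x_1 + ⋯ + x_n = k}`. -/
def hypersimplex (n k : ℕ) : Set (Fin n → ℝ) :=
  {x | (∀ i, 0 ≤ x i ∧ x i ≤ 1) ∧ ∑ i, x i = (k : ℝ)}

/-- For `s ⊆ ℝ^n` and a space `Y`, the equivalence relation on `s × Y` for which distinct points
`(x, c)` and `(y, c')` are equivalent iff `x = y ∈ ∂s`. Here `∂s` is the relative boundary of `s`,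
that is, its boundary inside its affine span. -/
def collapseSetoid {n : ℕ} (s : Set (Fin n → ℝ)) (Y : Type*) : Setoid (s × Y) where
  r p q := p = q ∨ (p.1 = q.1 ∧ (p.1 : Fin n → ℝ) ∈ intrinsicFrontier ℝ s)
  iseqv :=
    { refl := fun _ => Or.inl rfl
      symm := by
        rintro p q (h | ⟨h, hb⟩)
        · exact Or.inl h.symm
        · exact Or.inr ⟨h.symm, h ▸ hb⟩
      trans := by
        rintro p q r (rfl | ⟨h, hb⟩) (rfl | ⟨h', hb'⟩)
        · exact Or.inl rfl
        · exact Or.inr ⟨h', hb'⟩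
        · exact Or.inr ⟨h, hb⟩
        · exact Or.inr ⟨h.trans h', hb⟩ }

/-- The space `(s × Y)/≈`, with the quotient topology. -/
abbrev Collapse {n : ℕ} (s : Set (Fin n → ℝ)) (Y : Type*) : Type _ :=
  Quotient (collapseSetoid s Y)

/-- The equivalence relation on `X × Y × [0,1]` generated by `(x, y, 0) ∼ (x, y', 0)` and
`(x, y, 1) ∼ (x', y, 1)`. -/
def joinSetoid (X Y : Type*) : Setoid (X × Y × unitInterval) where
  r p q := p.2.2 = q.2.2 ∧ (p.1 = q.1 ∨ p.2.2 = 1) ∧ (p.2.1 = q.2.1 ∨ p.2.2 = 0)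
  iseqv :=
    { refl := fun _ => ⟨rfl, Or.inl rfl, Or.inl rfl⟩
      symm := by
        rintro p q ⟨h, h1, h2⟩
        exact ⟨h.symm, h1.imp Eq.symm (fun e => h ▸ e), h2.imp Eq.symm (fun e => h ▸ e)⟩
      trans := by
        rintro p q r ⟨h, h1, h2⟩ ⟨h', h1', h2'⟩
        refine ⟨h.trans h', ?_, ?_⟩
        · rcases h1 with h1 | h1
          · exact h1'.imp h1.trans (fun e => h.trans e)
          · exact Or.inr h1
        · rcases h2 with h2 | h2
          · exact h2'.imp h2.trans (fun e => h.trans e)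
          · exact Or.inr h2 }

/-- The topological join `X * Y` of two nonempty spaces, with the quotient topology. -/
abbrev Join (X Y : Type*) : Type _ := Quotient (joinSetoid X Y)

/-- The unit sphere `S²` in Euclidean space `ℝ³`. -/
abbrev S2 : Type := Metric.sphere (0 : EuclideanSpace ℝ (Fin 3)) 1

end OrbitSpace

namespace OrbitSpace

/-! All three spaces are quotients of compact spaces, and each relation is the fibre relation of a
continuous map onto one Hausdorff set, `model`; so all three are homeomorphic to `model`. For the
orbit space, pair complementary indices into complex numbers w₁ = z₁₂ + i z₃₄, w₂ = z₁₃ + i z₂₄, w₃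
= z₁₄ + i z₂₃. Every t fixes all Re w_k² and multiplies all Im w_k² by the common sign t₁t₂t₃t₄.
Conversely, these data up to a common sign of the imaginary parts determine z up to the action and a
global sign, which is trivial in ℝP⁵ (`exists_symSq_smul_eq`). Complex square roots give
surjectivity. The first component of `model` ranges over the ℓ¹ ball, an octahedron affinely
isomorphic to Δ₄,₂. The fibre over x is a copy of ℝP² scaled by 1 - ‖x‖₁², a point exactly on the
boundary: this is `Collapse`. Polar coordinates on the octahedron turn it into the join. -/

/-- A continuous map from a compact space to a Hausdorff space induces a homeomorphism from the
quotient by its fibres to its range. -/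
theorem nonempty_quotient_homeomorph_of_range_eq {X Z : Type*} [TopologicalSpace X]
    [CompactSpace X] [TopologicalSpace Z] [T2Space Z] (s : Setoid X) (f : X → Z)
    (hf : Continuous f) (h : ∀ p q, s p q ↔ f p = f q) {T : Set Z} (hT : Set.range f = T) :
    Nonempty (Quotient s ≃ₜ T) := by
  subst hT
  let g : Quotient s → Set.range f :=
    Quotient.lift (Set.rangeFactorization f) fun p q hpq => Subtype.ext ((h p q).1 hpq)
  have hg : Continuous g := Continuous.quotient_lift (hf.subtype_mk _) _
  have hb : Function.Bijective g := by
    constructor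
    · intro p q
      induction p using Quotient.inductionOn
      induction q using Quotient.inductionOn
      intro e
      exact Quotient.sound ((h _ _).2 (congrArg Subtype.val e))
    · rintro ⟨_, p, rfl⟩
      exact ⟨Quotient.mk _ p, rfl⟩
  exact ⟨Continuous.homeoOfEquivCompactToT2 (f := Equiv.ofBijective g hb) hg⟩

/-! ### Rank one symmetric matrices -/

/-- The matrix `y yᵀ`. -/
def outer {ι : Type*} (y : ι → ℝ) : ι → ι → ℝ := fun i j => y i * y j

theorem outer_smul {ι : Type*} (c : ℝ) (y : ι → ℝ) : outer (c • y) = c ^ 2 • outer y := by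
  funext i j
  simp only [outer, Pi.smul_apply, smul_eq_mul]
  ring

theorem outer_neg {ι : Type*} (y : ι → ℝ) : outer (-y) = outer y := by
  funext i j
  simp [outer]

theorem outer_zero {ι : Type*} : outer (0 : ι → ℝ) = 0 := by
  funext i j
  simp [outer]

theorem continuous_outer {ι : Type*} : Continuous (outer : (ι → ℝ) → ι → ι → ℝ) := by
  unfold outer
  fun_prop

/-- A diagonal entry at some j with y j ≠ 0 fixes y' j up to sign; column j then forces the same
sign on every coordinate. -/
theorem eq_or_eq_neg_of_outer_eq {ι : Type*} {y y' : ι → ℝ} (h : outer y = outer y') :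
    y' = y ∨ y' = -y := by
  have h' : ∀ i j, y i * y j = y' i * y' j := fun i j => congrFun (congrFun h i) j
  by_cases hy : ∃ j, y j ≠ 0
  · obtain ⟨j, hj⟩ := hy
    rcases mul_self_eq_mul_self_iff.1 (h' j j) with e | e
    · left
      funext i
      have := h' i j
      rw [← e] at this
      exact (mul_right_cancel₀ hj this).symm
    · right
      funext i
      have := h' i j
      have e' : y' j = -y j := by linarith
      rw [e'] at this
      have := mul_right_cancel₀ hj (this.trans (neg_mul_comm (y' i) (y j)).symm)
      simp [this]
  · push Not at hy
    left
    funext i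
    have := h' i i
    rw [hy i] at this ⊢
    simpa using this.symm

theorem sum_sq_eq_of_outer_eq {ι : Type*} [Fintype ι] {y y' : ι → ℝ} (h : outer y = outer y') :
    ∑ i, y i ^ 2 = ∑ i, y' i ^ 2 :=
  Finset.sum_congr rfl fun i _ => by
    simpa [outer, sq] using congrFun (congrFun h i) i

theorem sum_sq_pos {ι : Type*} [Fintype ι] {y : ι → ℝ} (hy : y ≠ 0) : 0 < ∑ i, y i ^ 2 := by
  obtain ⟨j, hj⟩ := Function.ne_iff.1 hy
  exact Finset.sum_pos' (fun i _ => sq_nonneg _) ⟨j, Finset.mem_univ _, sq_pos_of_ne_zero hj⟩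

theorem sum_sq_smul {ι : Type*} [Fintype ι] (c : ℝ) (y : ι → ℝ) :
    ∑ i, (c • y) i ^ 2 = c ^ 2 * ∑ i, y i ^ 2 := by
  simp [mul_pow, Finset.mul_sum]

/-! ### Real projective space -/

theorem isQuotientMap_mk' (n : ℕ) :
    Topology.IsQuotientMap (Projectivization.mk' ℝ : {v : Fin (n + 1) → ℝ // v ≠ 0} → RP n) :=
  ⟨⟨rfl⟩, fun p => Quotient.exists_rep p⟩

instance instCompactSpaceRP (n : ℕ) : CompactSpace (RP n) := by
  have h0 : ∀ v : Metric.sphere (0 : Fin (n + 1) → ℝ) 1, (v : Fin (n + 1) → ℝ) ≠ 0 := fun v =>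
    ne_zero_of_mem_unit_sphere v
  let g : Metric.sphere (0 : Fin (n + 1) → ℝ) 1 → RP n := fun v =>
    Projectivization.mk' ℝ ⟨v, h0 v⟩
  have hg : Continuous g := (isQuotientMap_mk' n).continuous.comp
    (continuous_subtype_val.subtype_mk h0)
  have hs : Function.Surjective g := by
    intro p
    induction p using Projectivization.ind with
    | h v hv =>
      have hn : ‖v‖ ≠ 0 := norm_ne_zero_iff.2 hv
      refine ⟨⟨‖v‖⁻¹ • v, by simp [norm_smul, hn]⟩, ?_⟩
      exact (Projectivization.mk_eq_mk_iff' ℝ _ _ _ _).2 ⟨‖v‖⁻¹, rfl⟩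
  exact hs.compactSpace hg

/-- The orthogonal projection onto a line, as a matrix. -/
noncomputable def proj {n : ℕ} : RP n → Fin (n + 1) → Fin (n + 1) → ℝ :=
  Projectivization.lift (fun v => (∑ i, v.1 i ^ 2)⁻¹ • outer v.1) (by
    rintro ⟨v, hv⟩ ⟨w, hw⟩ c (rfl : v = c • w)
    have hc : c ≠ 0 := by
      rintro rfl
      simp at hv
    have := (sum_sq_pos hw).ne'
    simp only [sum_sq_smul, outer_smul, smul_smul]
    congr 1
    field_simp)

theorem proj_mk {n : ℕ} (v : Fin (n + 1) → ℝ) (hv : v ≠ 0) :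
    proj (Projectivization.mk ℝ v hv) = (∑ i, v i ^ 2)⁻¹ • outer v := rfl

theorem continuous_proj {n : ℕ} : Continuous (proj : RP n → _) := by
  refine (isQuotientMap_mk' n).continuous_iff.2 ?_
  change Continuous fun v : {v : Fin (n + 1) → ℝ // v ≠ 0} => (∑ i, v.1 i ^ 2)⁻¹ • outer v.1
  have h : Continuous fun v : {v : Fin (n + 1) → ℝ // v ≠ 0} => ∑ i, v.1 i ^ 2 :=
    continuous_finsetSum _ fun i _ => ((continuous_apply i).comp continuous_subtype_val).pow 2
  refine Continuous.smul (Continuous.inv₀ h fun v => (sum_sq_pos v.2).ne') ?_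
  exact continuous_outer.comp continuous_subtype_val

theorem exists_proj_eq_outer {n : ℕ} (p : RP n) :
    ∃ y, proj p = outer y ∧ ∑ i, y i ^ 2 = 1 ∧ ∃ hy, p = Projectivization.mk ℝ y hy := by
  induction p using Projectivization.ind with
  | h v hv =>
    have hpos := sum_sq_pos hv
    have hs : (Real.sqrt (∑ i, v i ^ 2))⁻¹ ^ 2 = (∑ i, v i ^ 2)⁻¹ := by
      rw [inv_pow, Real.sq_sqrt hpos.le]
    have hne : (Real.sqrt (∑ i, v i ^ 2))⁻¹ ≠ 0 := inv_ne_zero (Real.sqrt_pos.2 hpos).ne'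
    refine ⟨(Real.sqrt (∑ i, v i ^ 2))⁻¹ • v, ?_, ?_, smul_ne_zero hne hv, ?_⟩
    · rw [proj_mk, outer_smul, hs]
    · rw [sum_sq_smul, hs, inv_mul_cancel₀ hpos.ne']
    · exact ((Projectivization.mk_eq_mk_iff' ℝ _ _ _ _).2 ⟨_, rfl⟩).symm

theorem proj_injective {n : ℕ} : Function.Injective (proj : RP n → _) := by
  intro p q h
  obtain ⟨y, hy, -, hy0, rfl⟩ := exists_proj_eq_outer p
  obtain ⟨y', hy', -, hy0', rfl⟩ := exists_proj_eq_outer q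
  rw [hy, hy'] at h
  refine (Projectivization.mk_eq_mk_iff' ℝ _ _ _ _).2 ?_
  rcases eq_or_eq_neg_of_outer_eq h with rfl | rfl
  · exact ⟨1, one_smul _ _⟩
  · exact ⟨-1, by simp⟩

/-- Two multiples `r • proj p`, `r • proj q` agree iff `p = q` or `r = 0`. -/
theorem smul_proj_eq_iff {n : ℕ} {r : ℝ} {p q : RP n} :
    r • proj p = r • proj q ↔ p = q ∨ r = 0 := by
  by_cases hr : r = 0
  · simp [hr]
  · simp [hr, smul_right_inj hr, proj_injective.eq_iff]

/-! ### The model space -/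

/-- The common model of the three spaces: the pairs `(x, y yᵀ)` with
`(|x₁| + |x₂| + |x₃|)² + |y|² = 1`. -/
def model : Set ((Fin 3 → ℝ) × (Fin 3 → Fin 3 → ℝ)) :=
  {p | ∃ y, p.2 = outer y ∧ (∑ k, |p.1 k|) ^ 2 + ∑ k, y k ^ 2 = 1}

theorem smul_proj_mem_model {x : Fin 3 → ℝ} (hx : ∑ k, |x k| ≤ 1) (p : RP 2) :
    (x, (1 - (∑ k, |x k|) ^ 2) • proj p) ∈ model := by
  obtain ⟨y, hy, hy1, -⟩ := exists_proj_eq_outer p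
  have h0 : 0 ≤ ∑ k, |x k| := Finset.sum_nonneg fun _ _ => abs_nonneg _
  have h1 : 0 ≤ 1 - (∑ k, |x k|) ^ 2 := by nlinarith
  refine ⟨Real.sqrt (1 - (∑ k, |x k|) ^ 2) • y, ?_, ?_⟩
  · rw [outer_smul, Real.sq_sqrt h1, hy]
  · rw [sum_sq_smul, Real.sq_sqrt h1, hy1]
    simp

/-- With `smul_proj_mem_model`, this presents `model` as a family of scaled projective planes over
the octahedron, the form used for both the collapse and the join. -/
theorem exists_of_mem_model {q : (Fin 3 → ℝ) × (Fin 3 → Fin 3 → ℝ)} (hq : q ∈ model) :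
    ∑ k, |q.1 k| ≤ 1 ∧ ∃ p : RP 2, q.2 = (1 - (∑ k, |q.1 k|) ^ 2) • proj p := by
  obtain ⟨y, hy, h⟩ := hq
  have h0 : 0 ≤ ∑ k, y k ^ 2 := Finset.sum_nonneg fun _ _ => sq_nonneg _
  refine ⟨by nlinarith, ?_⟩
  have e : 1 - (∑ k, |q.1 k|) ^ 2 = ∑ k, y k ^ 2 := by linarith
  rw [e, hy]
  by_cases hy0 : y = 0
  · subst hy0
    -- The scale is zero here, so any line serves.
    refine ⟨Projectivization.mk ℝ (fun _ => 1) (Function.ne_iff.2 ⟨0, one_ne_zero⟩), ?_⟩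
    simp [outer_zero]
  · refine ⟨Projectivization.mk ℝ y hy0, ?_⟩
    rw [proj_mk, smul_inv_smul₀ (sum_sq_pos hy0).ne']

theorem one_sub_sq_eq_zero_iff {r : ℝ} (hr : 0 ≤ r) : 1 - r ^ 2 = 0 ↔ r = 1 := by
  rw [sub_eq_zero, eq_comm, pow_eq_one_iff_of_nonneg hr two_ne_zero]

/-! ### The hypersimplex -/

theorem mem_intrinsicFrontier_hypersimplex (x : hypersimplex 4 2) :
    (x : Fin 4 → ℝ) ∈ intrinsicFrontier ℝ (hypersimplex 4 2) ↔
      ∃ i, (x : Fin 4 → ℝ) i = 0 ∨ (x : Fin 4 → ℝ) i = 1 := by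
  have hspan : ∀ y ∈ affineSpan ℝ (hypersimplex 4 2), ∑ i, y i = 2 := by
    intro y hy
    let L : (Fin 4 → ℝ) →ₗ[ℝ] ℝ := ∑ i, LinearMap.proj i
    have hL : ∀ z, L z = ∑ i, z i := fun z => by simp [L]
    have hle : affineSpan ℝ (hypersimplex 4 2) ≤ (affineSpan ℝ {(2 : ℝ)}).comap L.toAffineMap := by
      rw [affineSpan_le]
      intro z hz
      have := hz.2
      simp [hL, this]
    have := hle hy
    simpa [hL] using this
  have hxs : (x : Fin 4 → ℝ) ∈ affineSpan ℝ (hypersimplex 4 2) := subset_affineSpan ℝ _ x.2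
  have key : (x : Fin 4 → ℝ) ∈ intrinsicFrontier ℝ (hypersimplex 4 2) ↔
      (⟨x, hxs⟩ : affineSpan ℝ (hypersimplex 4 2)) ∉
        interior ((↑) ⁻¹' hypersimplex 4 2 : Set (affineSpan ℝ (hypersimplex 4 2))) := by
    rw [mem_intrinsicFrontier]
    constructor
    · rintro ⟨y, hy, hyx⟩
      have : y = ⟨x, hxs⟩ := Subtype.ext hyx
      exact this ▸ hy.2
    · intro h
      exact ⟨⟨x, hxs⟩, ⟨subset_closure x.2, h⟩, rfl⟩
  rw [key]
  constructor
  · intro h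
    by_contra! hne
    apply h
    rw [mem_interior]
    refine ⟨{y | ∀ i, 0 < (y : Fin 4 → ℝ) i ∧ (y : Fin 4 → ℝ) i < 1}, ?_, ?_, ?_⟩
    · intro y hy
      refine ⟨fun i => ⟨(hy i).1.le, (hy i).2.le⟩, ?_⟩
      simpa using hspan y y.2
    · simp only [Set.ofPred_forall]
      refine isOpen_iInter_of_finite fun i => ?_
      have hi : Continuous fun y : affineSpan ℝ (hypersimplex 4 2) => (y : Fin 4 → ℝ) i :=
        (continuous_apply i).comp continuous_subtype_val
      exact (isOpen_lt continuous_const hi).inter (isOpen_lt hi continuous_const)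
    · intro i
      exact ⟨lt_of_le_of_ne (x.2.1 i).1 (hne i).1.symm, lt_of_le_of_ne (x.2.1 i).2 (hne i).2⟩
  · rintro ⟨i, hi⟩ hint
    have hc : (fun _ => 1 / 2 : Fin 4 → ℝ) ∈ hypersimplex 4 2 := by
      refine ⟨fun _ => by norm_num, ?_⟩
      norm_num
    -- The line from x to the centre of the hypersimplex: a negative parameter moves away from the
    -- centre and so violates the bound that is tight at x.
    let γ : ℝ → affineSpan ℝ (hypersimplex 4 2) := fun ε =>
      ⟨AffineMap.lineMap (x : Fin 4 → ℝ) (fun _ => 1 / 2 : Fin 4 → ℝ) ε,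
        AffineMap.lineMap_mem ε hxs (subset_affineSpan ℝ _ hc)⟩
    have hγ : Continuous γ := AffineMap.lineMap_continuous.subtype_mk _
    have hγ0 : γ 0 = ⟨x, hxs⟩ := Subtype.ext (by simp [γ])
    have hev : ∀ᶠ ε in nhds (0 : ℝ), γ ε ∈
        interior ((↑) ⁻¹' hypersimplex 4 2 : Set (affineSpan ℝ (hypersimplex 4 2))) :=
      hγ.continuousAt.eventually (hγ0 ▸ isOpen_interior.mem_nhds hint)
    obtain ⟨ε, hε, hlt⟩ :=
      ((hev.filter_mono nhdsWithin_le_nhds).and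
        (self_mem_nhdsWithin : Set.Iio (0 : ℝ) ∈ nhdsWithin 0 (Set.Iio 0))).exists
    have hmem : γ ε ∈ ((↑) ⁻¹' hypersimplex 4 2 : Set (affineSpan ℝ (hypersimplex 4 2))) :=
      interior_subset hε
    have hval : (γ ε : Fin 4 → ℝ) i = ε * (1 / 2 - (x : Fin 4 → ℝ) i) + (x : Fin 4 → ℝ) i := by
      simp [γ, AffineMap.lineMap_apply]
    have hb := hmem.1 i
    rw [hval] at hb
    have hlt' : ε < 0 := hlt
    rcases hi with hi | hi <;> rw [hi] at hb <;> linarith [hb.1, hb.2]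

/-- The coordinates in which the hypersimplex `Δ_{4,2}` is the standard octahedron. -/
def octCoord (x : Fin 4 → ℝ) : Fin 3 → ℝ := ![x 0 + x 1 - 1, x 0 + x 2 - 1, x 0 + x 3 - 1]

theorem continuous_octCoord : Continuous octCoord := by
  refine continuous_pi fun i => ?_
  fin_cases i <;> simp [octCoord] <;> fun_prop

theorem sum_eq_of_mem_hypersimplex {x : Fin 4 → ℝ} (hx : x ∈ hypersimplex 4 2) :
    x 0 + x 1 + x 2 + x 3 = 2 := by
  simpa [Fin.sum_univ_four] using hx.2

/-- Since the x i sum to 2, the eight signed sums of the octahedral coordinates are ±(2 x i - 1).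
The ℓ¹ norm is therefore the maximum of |2 x i - 1|, and facets correspond to facets. -/
theorem sum_abs_octCoord_le {x : Fin 4 → ℝ} (hx : x ∈ hypersimplex 4 2) :
    ∑ k, |octCoord x k| ≤ 1 := by
  have hs := sum_eq_of_mem_hypersimplex hx
  have h0 := hx.1 0
  have h1 := hx.1 1
  have h2 := hx.1 2
  have h3 := hx.1 3
  simp only [octCoord, Fin.sum_univ_three, Matrix.cons_val]
  rcases abs_cases (x 0 + x 1 - 1) with ⟨e1, -⟩ | ⟨e1, -⟩ <;>
  rcases abs_cases (x 0 + x 2 - 1) with ⟨e2, -⟩ | ⟨e2, -⟩ <;>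
  rcases abs_cases (x 0 + x 3 - 1) with ⟨e3, -⟩ | ⟨e3, -⟩ <;>
  rw [e1, e2, e3] <;> linarith

theorem sum_abs_octCoord_eq_one_iff {x : Fin 4 → ℝ} (hx : x ∈ hypersimplex 4 2) :
    ∑ k, |octCoord x k| = 1 ↔ ∃ i, x i = 0 ∨ x i = 1 := by
  have hs := sum_eq_of_mem_hypersimplex hx
  refine ⟨fun h => ?_, fun h => le_antisymm (sum_abs_octCoord_le hx) ?_⟩
  · simp only [octCoord, Fin.sum_univ_three, Matrix.cons_val] at h
    by_contra! hne
    have l (i) : 0 < x i := lt_of_le_of_ne (hx.1 i).1 (hne i).1.symm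
    have u (i) : x i < 1 := lt_of_le_of_ne (hx.1 i).2 (hne i).2
    have l0 := l 0
    have l1 := l 1
    have l2 := l 2
    have l3 := l 3
    have u0 := u 0
    have u1 := u 1
    have u2 := u 2
    have u3 := u 3
    rcases abs_cases (x 0 + x 1 - 1) with ⟨e1, -⟩ | ⟨e1, -⟩ <;>
    rcases abs_cases (x 0 + x 2 - 1) with ⟨e2, -⟩ | ⟨e2, -⟩ <;>
    rcases abs_cases (x 0 + x 3 - 1) with ⟨e3, -⟩ | ⟨e3, -⟩ <;>
    rw [e1, e2, e3] at h <;> linarith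
  · simp only [octCoord, Fin.sum_univ_three, Matrix.cons_val]
    have a1 := le_abs_self (x 0 + x 1 - 1)
    have a2 := neg_abs_le (x 0 + x 1 - 1)
    have b1 := le_abs_self (x 0 + x 2 - 1)
    have b2 := neg_abs_le (x 0 + x 2 - 1)
    have c1 := le_abs_self (x 0 + x 3 - 1)
    have c2 := neg_abs_le (x 0 + x 3 - 1)
    obtain ⟨i, hi⟩ := h
    fin_cases i <;> simp only [Fin.zero_eta, Fin.mk_one, Fin.reduceFinMk] at hi <;>
      rcases hi with hi | hi <;> linarith

theorem octCoord_injOn : Set.InjOn octCoord (hypersimplex 4 2) := by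
  intro x hx y hy h
  have hsx := sum_eq_of_mem_hypersimplex hx
  have hsy := sum_eq_of_mem_hypersimplex hy
  have h0 := congrFun h 0
  have h1 := congrFun h 1
  have h2 := congrFun h 2
  simp only [octCoord, Matrix.cons_val] at h0 h1 h2
  funext i
  fin_cases i <;> simp only [Fin.zero_eta, Fin.mk_one, Fin.reduceFinMk] <;> linarith

theorem exists_octCoord_eq {a : Fin 3 → ℝ} (ha : ∑ k, |a k| ≤ 1) :
    ∃ x ∈ hypersimplex 4 2, octCoord x = a := by
  rw [Fin.sum_univ_three] at ha
  have a1 := le_abs_self (a 0)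
  have a2 := neg_abs_le (a 0)
  have b1 := le_abs_self (a 1)
  have b2 := neg_abs_le (a 1)
  have c1 := le_abs_self (a 2)
  have c2 := neg_abs_le (a 2)
  -- Solves 2 x i - 1 = signed sum of the a k for each i.
  refine ⟨![(1 + a 0 + a 1 + a 2) / 2, (1 + a 0 - a 1 - a 2) / 2, (1 - a 0 + a 1 - a 2) / 2,
    (1 - a 0 - a 1 + a 2) / 2], ⟨fun i => ?_, ?_⟩, ?_⟩
  · fin_cases i <;> simp <;> constructor <;> linarith
  · simp [Fin.sum_univ_four]
    ring
  · funext i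
    fin_cases i <;> simp [octCoord] <;> ring

instance instCompactSpaceHypersimplex (n k : ℕ) : CompactSpace (hypersimplex n k) := by
  have h : IsCompact (Set.Icc (0 : Fin n → ℝ) 1 ∩ {x | ∑ i, x i = (k : ℝ)}) :=
    isCompact_Icc.inter_right (isClosed_eq (by fun_prop) continuous_const)
  refine isCompact_iff_compactSpace.1 ?_
  convert h using 1
  ext x
  simp [hypersimplex, Pi.le_def, forall_and]

theorem nonempty_collapse_homeomorph_model :
    Nonempty (Collapse (hypersimplex 4 2) (RP 2) ≃ₜ model) := by
  refine nonempty_quotient_homeomorph_of_range_eq _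
    (fun p => (octCoord p.1, (1 - (∑ k, |octCoord p.1 k|) ^ 2) • proj p.2)) ?_ ?_ ?_
  · have h1 : Continuous fun p : hypersimplex 4 2 × RP 2 => octCoord p.1 :=
      continuous_octCoord.comp (continuous_subtype_val.comp continuous_fst)
    have h2 : Continuous fun p : hypersimplex 4 2 × RP 2 => proj p.2 :=
      continuous_proj.comp continuous_snd
    fun_prop
  · rintro ⟨x, p⟩ ⟨y, q⟩
    have hS : 0 ≤ ∑ k, |octCoord x k| := Finset.sum_nonneg fun _ _ => abs_nonneg _
    change ((x, p) = (y, q) ∨ (x = y ∧ _)) ↔ _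
    simp only [Prod.mk.injEq, mem_intrinsicFrontier_hypersimplex,
      ← sum_abs_octCoord_eq_one_iff x.2]
    constructor
    · rintro (⟨rfl, rfl⟩ | ⟨rfl, h⟩)
      · exact ⟨rfl, rfl⟩
      · simp [h]
    · rintro ⟨h, h'⟩
      obtain rfl : x = y := Subtype.ext (octCoord_injOn x.2 y.2 h)
      rw [smul_proj_eq_iff, one_sub_sq_eq_zero_iff hS] at h'
      exact h'.imp (fun e => ⟨rfl, e⟩) fun e => ⟨rfl, e⟩
  · ext q
    constructor
    · rintro ⟨⟨x, p⟩, rfl⟩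
      exact smul_proj_mem_model (sum_abs_octCoord_le x.2) p
    · intro hq
      obtain ⟨h1, p, hp⟩ := exists_of_mem_model hq
      obtain ⟨x, hx, hxq⟩ := exists_octCoord_eq h1
      exact ⟨(⟨x, hx⟩, p), Prod.ext hxq (by rw [hp]; simp only [hxq])⟩

/-! ### The join -/

theorem sum_abs_pos {ι : Type*} [Fintype ι] {x : ι → ℝ} (hx : x ≠ 0) : 0 < ∑ k, |x k| := by
  obtain ⟨j, hj⟩ := Function.ne_iff.1 hx
  exact Finset.sum_pos' (fun i _ => abs_nonneg _) ⟨j, Finset.mem_univ _, abs_pos.2 hj⟩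

theorem sum_abs_smul {ι : Type*} [Fintype ι] (c : ℝ) (x : ι → ℝ) :
    ∑ k, |(c • x) k| = |c| * ∑ k, |x k| := by
  simp [abs_mul, Finset.mul_sum]

/-- The radial projection of the round sphere to the surface of the octahedron. -/
noncomputable def toOct (x : S2) : Fin 3 → ℝ := (∑ k, |x.1 k|)⁻¹ • x.1.ofLp

theorem S2_ofLp_ne_zero (x : S2) : x.1.ofLp ≠ 0 := fun h =>
  ne_zero_of_mem_unit_sphere x (by ext i; exact congrFun h i)

theorem sum_abs_toOct (x : S2) : ∑ k, |toOct x k| = 1 := by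
  have h := sum_abs_pos (S2_ofLp_ne_zero x)
  rw [toOct, sum_abs_smul, abs_of_pos (inv_pos.2 h), inv_mul_cancel₀ h.ne']

theorem continuous_toOct : Continuous toOct := by
  unfold toOct
  have h : Continuous fun x : S2 => x.1.ofLp :=
    (PiLp.continuous_ofLp 2 _).comp continuous_subtype_val
  have h' : Continuous fun x : S2 => ∑ k, |x.1 k| :=
    continuous_finsetSum _ fun k _ => ((continuous_apply k).comp h).abs
  exact (h'.inv₀ fun x => (sum_abs_pos (S2_ofLp_ne_zero x)).ne').smul h

theorem toOct_injective : Function.Injective toOct := by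
  intro x y h
  have hx := inv_pos.2 (sum_abs_pos (S2_ofLp_ne_zero x))
  have hy := inv_pos.2 (sum_abs_pos (S2_ofLp_ne_zero y))
  have h' : (∑ k, |x.1 k|)⁻¹ • x.1 = (∑ k, |y.1 k|)⁻¹ • y.1 := by
    ext i
    exact congrFun h i
  have hn := congrArg norm h'
  rw [norm_smul, norm_smul, norm_eq_of_mem_sphere, norm_eq_of_mem_sphere, Real.norm_of_nonneg hx.le,
    Real.norm_of_nonneg hy.le, mul_one, mul_one] at hn
  rw [hn] at h'
  exact Subtype.ext (smul_right_injective _ hy.ne' h')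

theorem exists_toOct_eq {a : Fin 3 → ℝ} (ha : ∑ k, |a k| = 1) : ∃ x, toOct x = a := by
  have h0 : WithLp.toLp 2 a ≠ 0 := by
    intro h
    have : a = 0 := by simpa using h
    simp [this] at ha
  have hn : 0 < ‖WithLp.toLp 2 a‖⁻¹ := inv_pos.2 (norm_pos_iff.2 h0)
  refine ⟨⟨‖WithLp.toLp 2 a‖⁻¹ • WithLp.toLp 2 a, ?_⟩, ?_⟩
  · simp [norm_smul, h0]
  · change (∑ k, |(‖WithLp.toLp 2 a‖⁻¹ • a) k|)⁻¹ • (‖WithLp.toLp 2 a‖⁻¹ • a) = a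
    rw [sum_abs_smul, ha, mul_one, abs_of_pos hn, inv_smul_smul₀ hn.ne']

/-- The join parameter is t = 1 - ‖x‖₁: the octahedral component vanishes at t = 1, the projective
one at t = 0. -/
theorem nonempty_join_homeomorph_model : Nonempty (Join S2 (RP 2) ≃ₜ model) := by
  have hS : ∀ (x : S2) (t : unitInterval), ∑ k, |((1 - t.1) • toOct x) k| = 1 - t.1 :=
    fun x t => by
      rw [sum_abs_smul, sum_abs_toOct, mul_one, abs_of_nonneg (by linarith [t.2.2])]
  refine nonempty_quotient_homeomorph_of_range_eq _
    (fun p => ((1 - p.2.2.1) • toOct p.1, (1 - (1 - p.2.2.1) ^ 2) • proj p.2.1)) ?_ ?_ ?_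
  · have h1 : Continuous fun p : S2 × RP 2 × unitInterval => toOct p.1 :=
      continuous_toOct.comp continuous_fst
    have h2 : Continuous fun p : S2 × RP 2 × unitInterval => proj p.2.1 :=
      continuous_proj.comp (continuous_fst.comp continuous_snd)
    fun_prop
  · rintro ⟨x, p, s⟩ ⟨y, q, t⟩
    change (s = t ∧ (x = y ∨ s = 1) ∧ (p = q ∨ s = 0)) ↔ _
    have hs1 : s = 1 ↔ 1 - s.1 = 0 := by
      rw [Subtype.ext_iff, sub_eq_zero, eq_comm]
      rfl
    have hs0 : s = 0 ↔ 1 - (1 - s.1) ^ 2 = 0 := by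
      rw [one_sub_sq_eq_zero_iff (by linarith [s.2.2]), Subtype.ext_iff]
      simp
    simp only [Prod.mk.injEq]
    constructor
    · rintro ⟨rfl, h1, h2⟩
      refine ⟨?_, smul_proj_eq_iff.2 (h2.imp_right hs0.1)⟩
      rcases h1 with rfl | h1
      · rfl
      · rw [hs1.1 h1, zero_smul, zero_smul]
    · rintro ⟨h1, h2⟩
      have hst : s = t := by
        have := hS x s
        rw [h1, hS y t] at this
        exact Subtype.ext (by linarith)
      subst hst
      refine ⟨rfl, ?_, (smul_proj_eq_iff.1 h2).imp_right hs0.2⟩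
      by_cases h : 1 - s.1 = 0
      · exact Or.inr (hs1.2 h)
      · exact Or.inl (toOct_injective (smul_right_injective _ h h1))
  · ext q
    constructor
    · rintro ⟨⟨x, p, t⟩, rfl⟩
      have := smul_proj_mem_model (x := (1 - t.1) • toOct x)
        ((hS x t).le.trans (by linarith [t.2.1])) p
      rwa [hS] at this
    · intro hq
      obtain ⟨h1, p, hp⟩ := exists_of_mem_model hq
      obtain ⟨a, A⟩ := q
      simp only at h1 hp
      subst hp
      have h0 : 0 ≤ ∑ k, |a k| := Finset.sum_nonneg fun _ _ => abs_nonneg _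
      have hx : ∃ x, (∑ k, |a k|) • toOct x = a := by
        by_cases ha : a = 0
        -- At the centre any point of the sphere serves.
        · obtain ⟨x, -⟩ := exists_toOct_eq (a := Pi.single 0 1) (by simp [Fin.sum_univ_three])
          exact ⟨x, by simp [ha]⟩
        · have hpos := sum_abs_pos ha
          obtain ⟨x, hx⟩ := exists_toOct_eq (a := (∑ k, |a k|)⁻¹ • a) (by
            rw [sum_abs_smul, abs_of_pos (inv_pos.2 hpos), inv_mul_cancel₀ hpos.ne'])
          exact ⟨x, by rw [hx, smul_inv_smul₀ hpos.ne']⟩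
      obtain ⟨x, hx⟩ := hx
      refine ⟨(x, p, ⟨1 - ∑ k, |a k|, by linarith, by linarith⟩), ?_⟩
      simp [hx]

/-! ### The orbit space -/

/-- The real parts of the squares of `z₁₂ + i z₃₄`, `z₁₃ + i z₂₄`, `z₁₄ + i z₂₃`. -/
def sqRe (z : Fin 6 → ℝ) : Fin 3 → ℝ := ![z 0 ^ 2 - z 5 ^ 2, z 1 ^ 2 - z 4 ^ 2, z 2 ^ 2 - z 3 ^ 2]

/-- The imaginary parts of the squares of `z₁₂ + i z₃₄`, `z₁₃ + i z₂₄`, `z₁₄ + i z₂₃`. -/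
def sqIm (z : Fin 6 → ℝ) : Fin 3 → ℝ := ![2 * z 0 * z 5, 2 * z 1 * z 4, 2 * z 2 * z 3]

theorem sqRe_smul (c : ℝ) (z : Fin 6 → ℝ) : sqRe (c • z) = c ^ 2 • sqRe z := by
  funext i
  fin_cases i <;> simp [sqRe] <;> ring

theorem sqIm_smul (c : ℝ) (z : Fin 6 → ℝ) : sqIm (c • z) = c ^ 2 • sqIm z := by
  funext i
  fin_cases i <;> simp [sqIm] <;> ring

theorem continuous_sqRe : Continuous sqRe := by
  refine continuous_pi fun i => ?_
  fin_cases i <;> simp [sqRe] <;> fun_prop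

theorem continuous_sqIm : Continuous sqIm := by
  refine continuous_pi fun i => ?_
  fin_cases i <;> simp [sqIm] <;> fun_prop

/-- The square of the scale by which `(sqRe z, sqIm z)` is normalised. -/
def scaleSq (z : Fin 6 → ℝ) : ℝ := (∑ k, |sqRe z k|) ^ 2 + ∑ k, sqIm z k ^ 2

theorem scaleSq_smul (c : ℝ) (z : Fin 6 → ℝ) : scaleSq (c • z) = (c ^ 2) ^ 2 * scaleSq z := by
  rw [scaleSq, sqRe_smul, sqIm_smul, sum_abs_smul, sum_sq_smul, abs_of_nonneg (sq_nonneg c),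
    scaleSq]
  ring

theorem continuous_scaleSq : Continuous scaleSq := by
  have h1 := continuous_sqRe
  have h2 := continuous_sqIm
  unfold scaleSq
  fun_prop

/-- For w = u + iv, |w|⁴ = (Re w²)² + (Im w²)². -/
theorem eq_zero_of_sq_sub_sq_eq_zero {u v : ℝ} (h1 : u ^ 2 - v ^ 2 = 0) (h2 : 2 * u * v = 0) :
    u = 0 ∧ v = 0 := by
  have h : (u ^ 2 + v ^ 2) ^ 2 = 0 := by
    linear_combination (u ^ 2 - v ^ 2) * h1 + 2 * u * v * h2
  have h' : u ^ 2 + v ^ 2 = 0 := by simpa using h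
  constructor <;> nlinarith [sq_nonneg u, sq_nonneg v]

theorem scaleSq_pos {z : Fin 6 → ℝ} (hz : z ≠ 0) : 0 < scaleSq z := by
  have h1 : 0 ≤ (∑ k, |sqRe z k|) ^ 2 := sq_nonneg _
  have h2 : 0 ≤ ∑ k, sqIm z k ^ 2 := Finset.sum_nonneg fun _ _ => sq_nonneg _
  by_cases hre : sqRe z = 0
  · by_cases him : sqIm z = 0
    · exfalso
      apply hz
      have r (k) := congrFun hre k
      have i (k) := congrFun him k
      have e0 := eq_zero_of_sq_sub_sq_eq_zero (r 0) (i 0)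
      have e1 := eq_zero_of_sq_sub_sq_eq_zero (r 1) (i 1)
      have e2 := eq_zero_of_sq_sub_sq_eq_zero (r 2) (i 2)
      funext j
      fin_cases j
      exacts [e0.1, e1.1, e2.1, e2.2, e1.2, e0.2]
    · exact add_pos_of_nonneg_of_pos h1 (sum_sq_pos him)
  · exact add_pos_of_pos_of_nonneg (pow_pos (sum_abs_pos hre) 2) h2

/-- The pair `(sqRe z, sqIm z (sqIm z)ᵀ)`, normalised to lie in the model space. -/
noncomputable def vecToModel (z : Fin 6 → ℝ) : (Fin 3 → ℝ) × (Fin 3 → Fin 3 → ℝ) :=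
  ((Real.sqrt (scaleSq z))⁻¹ • sqRe z, (scaleSq z)⁻¹ • outer (sqIm z))

theorem vecToModel_smul {c : ℝ} (hc : c ≠ 0) (z : Fin 6 → ℝ) :
    vecToModel (c • z) = vecToModel z := by
  simp only [vecToModel, scaleSq_smul, sqRe_smul, sqIm_smul, outer_smul, smul_smul,
    Real.sqrt_mul (sq_nonneg (c ^ 2)), Real.sqrt_sq (sq_nonneg c), mul_inv]
  congr 2
  · rw [mul_right_comm, inv_mul_cancel₀ (pow_ne_zero 2 hc), one_mul]
  · rw [mul_right_comm, inv_mul_cancel₀ (pow_ne_zero 2 (pow_ne_zero 2 hc)), one_mul]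

/-- The map from `ℝP⁵` to the model space. -/
noncomputable def toModel : RP 5 → (Fin 3 → ℝ) × (Fin 3 → Fin 3 → ℝ) :=
  Projectivization.lift (fun z => vecToModel z.1) (by
    rintro ⟨v, hv⟩ ⟨w, hw⟩ c (rfl : v = c • w)
    exact vecToModel_smul (left_ne_zero_of_smul hv) w)

theorem toModel_mk (z : Fin 6 → ℝ) (hz : z ≠ 0) : toModel (Projectivization.mk ℝ z hz) =
    ((Real.sqrt (scaleSq z))⁻¹ • sqRe z, (scaleSq z)⁻¹ • outer (sqIm z)) := rfl

theorem continuous_toModel : Continuous toModel := by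
  refine (isQuotientMap_mk' 5).continuous_iff.2 ?_
  change Continuous fun z : {z : Fin 6 → ℝ // z ≠ 0} =>
    ((Real.sqrt (scaleSq z.1))⁻¹ • sqRe z.1, (scaleSq z.1)⁻¹ • outer (sqIm z.1))
  have h0 : Continuous fun z : {z : Fin 6 → ℝ // z ≠ 0} => scaleSq z.1 :=
    continuous_scaleSq.comp continuous_subtype_val
  refine Continuous.prodMk (Continuous.smul (Continuous.inv₀ h0.sqrt fun z => ?_) ?_)
    (Continuous.smul (Continuous.inv₀ h0 fun z => (scaleSq_pos z.2).ne') ?_)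
  · exact (Real.sqrt_pos.2 (scaleSq_pos z.2)).ne'
  · exact continuous_sqRe.comp continuous_subtype_val
  · exact continuous_outer.comp (continuous_sqIm.comp continuous_subtype_val)

theorem exists_mk_eq_scaleSq_eq_one (p : RP 5) :
    ∃ z hz, p = Projectivization.mk ℝ z hz ∧ scaleSq z = 1 := by
  induction p using Projectivization.ind with
  | h z hz =>
    have h := scaleSq_pos hz
    have hs := Real.sqrt_pos.2 h
    -- A fourth root, as `scaleSq` is homogeneous of degree four.
    have hc : (Real.sqrt (Real.sqrt (scaleSq z)))⁻¹ ≠ 0 := inv_ne_zero (Real.sqrt_pos.2 hs).ne'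
    refine ⟨_, smul_ne_zero hc hz, ((Projectivization.mk_eq_mk_iff' ℝ _ _ _ _).2 ⟨_, rfl⟩).symm, ?_⟩
    rw [scaleSq_smul, inv_pow, Real.sq_sqrt hs.le, inv_pow, Real.sq_sqrt h.le,
      inv_mul_cancel₀ h.ne']

theorem toModel_mk_of_scaleSq_eq_one {z : Fin 6 → ℝ} (hz : z ≠ 0) (h : scaleSq z = 1) :
    toModel (Projectivization.mk ℝ z hz) = (sqRe z, outer (sqIm z)) := by
  simp [toModel_mk, h]

/-- A complex number has a square root, in real coordinates. -/
theorem exists_sq_sub_sq_eq (a b : ℝ) : ∃ u v : ℝ, u ^ 2 - v ^ 2 = a ∧ 2 * u * v = b := by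
  obtain ⟨w, hw⟩ := IsAlgClosed.exists_pow_nat_eq (⟨a, b⟩ : ℂ) (n := 2) two_pos
  refine ⟨w.re, w.im, ?_, ?_⟩
  · have := congrArg Complex.re hw
    simp only [sq, Complex.mul_re] at this
    linarith
  · have := congrArg Complex.im hw
    simp only [sq, Complex.mul_im] at this
    linarith

theorem exists_sqRe_eq_sqIm_eq (a b : Fin 3 → ℝ) : ∃ z, sqRe z = a ∧ sqIm z = b := by
  choose u v h1 h2 using fun k => exists_sq_sub_sq_eq (a k) (b k)
  refine ⟨![u 0, u 1, u 2, v 2, v 1, v 0], ?_, ?_⟩ <;> funext k <;> fin_cases k <;>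
    simp [sqRe, sqIm, h1, h2]

theorem range_toModel : Set.range toModel = model := by
  ext q
  constructor
  · rintro ⟨p, rfl⟩
    obtain ⟨z, hz, rfl, h⟩ := exists_mk_eq_scaleSq_eq_one p
    rw [toModel_mk_of_scaleSq_eq_one hz h]
    exact ⟨_, rfl, h⟩
  · rintro ⟨y, hy, h⟩
    obtain ⟨z, h1, h2⟩ := exists_sqRe_eq_sqIm_eq q.1 y
    have hs : scaleSq z = 1 := by rw [scaleSq, h1, h2, h]
    have hz : z ≠ 0 := by
      rintro rfl
      simp [scaleSq, sqRe, sqIm, Fin.sum_univ_three] at hs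
    refine ⟨Projectivization.mk ℝ z hz, ?_⟩
    rw [toModel_mk_of_scaleSq_eq_one hz hs, h1, h2, ← hy]

theorem smul_mk (t : Z2 4) (z : Fin 6 → ℝ) (hz : z ≠ 0) :
    t • (Projectivization.mk ℝ z hz : RP 5) =
      Projectivization.mk ℝ (symSq t • z) ((smul_ne_zero_iff_ne _).2 hz) := rfl

theorem unit_smul_sq (e : ℤˣ) (a : ℝ) : (e • a) ^ 2 = a ^ 2 := by
  rcases Int.units_eq_one_or e with rfl | rfl <;> simp

theorem sqRe_unit_smul (e : Z2 6) (z : Fin 6 → ℝ) : sqRe (e • z) = sqRe z := by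
  simp only [sqRe, Pi.smul_apply', unit_smul_sq]

/-- Each imaginary part multiplies coordinates with complementary index pairs, so each acquires the
same sign t 0 * t 1 * t 2 * t 3. -/
theorem sqIm_symSq_smul (t : Z2 4) (z : Fin 6 → ℝ) :
    sqIm (symSq t • z) = sqIm z ∨ sqIm (symSq t • z) = -sqIm z := by
  rcases Int.units_eq_one_or (t 0) with h0 | h0 <;>
  rcases Int.units_eq_one_or (t 1) with h1 | h1 <;>
  rcases Int.units_eq_one_or (t 2) with h2 | h2 <;>
  rcases Int.units_eq_one_or (t 3) with h3 | h3 <;>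
  simp [sqIm, symSq, Pi.smul_apply', h0, h1, h2, h3]

theorem toModel_smul (t : Z2 4) (p : RP 5) : toModel (t • p) = toModel p := by
  induction p using Projectivization.ind with
  | h z hz =>
    have h : outer (sqIm (symSq t • z)) = outer (sqIm z) := by
      rcases sqIm_symSq_smul t z with h | h <;> rw [h]
      rw [outer_neg]
    rw [smul_mk, toModel_mk, toModel_mk, scaleSq, scaleSq, sqRe_unit_smul,
      sum_sq_eq_of_outer_eq h, h]

/-- A complex number is determined by its square up to sign; σ = -1 replaces u + iv by its
conjugate. -/
theorem exists_unit_smul_eq {u v u' v' : ℝ} {σ : ℤˣ} (h1 : u' ^ 2 - v' ^ 2 = u ^ 2 - v ^ 2)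
    (h2 : 2 * u' * v' = σ • (2 * u * v)) : ∃ e : ℤˣ, u' = e • u ∧ v' = (e * σ) • v := by
  have key : ∀ s : ℝ, s ^ 2 = 1 → 2 * u' * v' = s * (2 * u * v) →
      (u' = u ∧ v' = s * v) ∨ (u' = -u ∧ v' = -(s * v)) := by
    intro s hs h
    have hz : (⟨u', v'⟩ : ℂ) ^ 2 = (⟨u, s * v⟩ : ℂ) ^ 2 := by
      apply Complex.ext
      · simp only [sq, Complex.mul_re]
        linear_combination h1 + v ^ 2 * hs
      · simp only [sq, Complex.mul_im]
        linear_combination h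
    rcases sq_eq_sq_iff_eq_or_eq_neg.1 hz with e | e
    · exact Or.inl ⟨congrArg Complex.re e, congrArg Complex.im e⟩
    · exact Or.inr ⟨congrArg Complex.re e, congrArg Complex.im e⟩
  rcases Int.units_eq_one_or σ with rfl | rfl
  · rcases key 1 (by norm_num) (by simpa using h2) with ⟨a, b⟩ | ⟨a, b⟩
    · exact ⟨1, by simp [a], by simp [b]⟩
    · exact ⟨-1, by simp [a], by simp [b]⟩
  · rcases key (-1) (by norm_num) (by simpa using h2) with ⟨a, b⟩ | ⟨a, b⟩
    · exact ⟨1, by simp [a], by simp [b]⟩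
    · exact ⟨-1, by simp [a], by simp [b]⟩

theorem exists_symSq_smul_eq {z z' : Fin 6 → ℝ} {σ : ℤˣ} (h1 : sqRe z' = sqRe z)
    (h2 : sqIm z' = σ • sqIm z) : ∃ (t : Z2 4) (δ : ℤˣ), z' = δ • (symSq t • z) := by
  obtain ⟨a, ha, ha'⟩ := exists_unit_smul_eq (congrFun h1 0) (congrFun h2 0)
  obtain ⟨b, hb, hb'⟩ := exists_unit_smul_eq (congrFun h1 1) (congrFun h2 1)
  obtain ⟨c, hc, hc'⟩ := exists_unit_smul_eq (congrFun h1 2) (congrFun h2 2)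
  -- Normalise t 0 = 1. The first three coordinates require t 1, t 2, t 3 to be δa, δb, δc, and then
  -- δ * t 1 * t 2 = c * σ forces δ = abcσ.
  refine ⟨![1, b * c * σ, a * c * σ, a * b * σ], a * b * c * σ, ?_⟩
  funext j
  rcases Int.units_eq_one_or a with rfl | rfl <;> rcases Int.units_eq_one_or b with rfl | rfl <;>
  rcases Int.units_eq_one_or c with rfl | rfl <;> rcases Int.units_eq_one_or σ with rfl | rfl <;>
  fin_cases j <;> simp [symSq, Pi.smul_apply', *]

theorem orbitRel_iff_toModel_eq (p q : RP 5) :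
    MulAction.orbitRel (Z2 4) (RP 5) p q ↔ toModel p = toModel q := by
  rw [MulAction.orbitRel_apply, MulAction.mem_orbit_iff]
  constructor
  · rintro ⟨t, rfl⟩
    exact toModel_smul t q
  · intro h
    obtain ⟨z', hz', rfl, hs'⟩ := exists_mk_eq_scaleSq_eq_one p
    obtain ⟨z, hz, rfl, hs⟩ := exists_mk_eq_scaleSq_eq_one q
    rw [toModel_mk_of_scaleSq_eq_one _ hs, toModel_mk_of_scaleSq_eq_one _ hs',
      Prod.mk.injEq] at h
    have hσ : ∃ σ : ℤˣ, sqIm z' = σ • sqIm z := by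
      rcases eq_or_eq_neg_of_outer_eq h.2.symm with e | e
      · exact ⟨1, by rw [e, one_smul]⟩
      · exact ⟨-1, by rw [e]; simp⟩
    obtain ⟨σ, hσ⟩ := hσ
    obtain ⟨t, δ, hδ⟩ := exists_symSq_smul_eq h.1 hσ
    refine ⟨t, ?_⟩
    rw [smul_mk]
    refine ((Projectivization.mk_eq_mk_iff' ℝ _ _ _ _).2 ?_).symm
    rcases Int.units_eq_one_or δ with rfl | rfl
    · exact ⟨1, by rw [hδ, one_smul, one_smul]⟩
    · exact ⟨-1, by rw [hδ]; simp⟩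

theorem nonempty_orbitSpace_homeomorph_model : Nonempty (RP5ModZ24 ≃ₜ model) :=
  nonempty_quotient_homeomorph_of_range_eq _ toModel continuous_toModel orbitRel_iff_toModel_eq
    range_toModel

end OrbitSpace

theorem mainTheorem7 :
    Nonempty (OrbitSpace.RP5ModZ24 ≃ₜ
      OrbitSpace.Collapse (OrbitSpace.hypersimplex 4 2) (OrbitSpace.RP 2)) ∧
    Nonempty (OrbitSpace.RP5ModZ24 ≃ₜ OrbitSpace.Join OrbitSpace.S2 (OrbitSpace.RP 2)) := by
  obtain ⟨f⟩ := OrbitSpace.nonempty_orbitSpace_homeomorph_model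
  obtain ⟨g⟩ := OrbitSpace.nonempty_collapse_homeomorph_model
  obtain ⟨h⟩ := OrbitSpace.nonempty_join_homeomorph_model
  exact ⟨⟨f.trans g.symm⟩, ⟨f.trans h.symm⟩⟩
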